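/- For an integer $n\ge 2$ let $\Phi_n$ be the $n$-th cyclotomic polynomial, $m=\varphi(n)$ its degree, $\zeta_1,\dots,\zeta_m$ the primitive $n$-th roots of unity in $\mathbb{C}$ in any order, and $V_{\Phi_n}=(\zeta_i^{\,j-1})_{1\le i,j\le m}$ the corresponding Vandermonde matrix. For an invertible complex square matrix $A$ let $\mathrm{Cond}(A)=\|A\|\,\|A^{-1}\|$, where $\|A\|=\sqrt{\sum_{i,j}|a_{ij}|^2}$ is the Frobenius norm. Put $$B(n)=n^{\,n^{1/\log\log n}+\frac{\log n}{\log\log n}+3}\; e^{\,n^{1/\log\log n}},$$ where $\log$ is the natural logarithm. Then $V_{\Phi_n}$ is invertible for all $n\ge 2$, and $$\mathrm{Cond}(V_{\Phi_n})=\mathcal{O}(B(n))\qquad(n\ge 2),$$ that is, there is an absolute constant $C>0$ such that $\mathrm{Cond}(V_{\Phi_n})\le C\,B(n)$ for every $n\ge 2$ and every ordering of the roots. Moreover this bound is subexponential in $n$: for every $\varepsilon>0$, $B(n)=\mathcal{O}(e^{n^{\varepsilon}})$ as $n\to\infty$. -/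

import Mathlib

/-- The Vandermonde matrix `V_f` of an integer polynomial `f`: its `i`-th row is
`(1, θ_i, …, θ_i ^ (m - 1))`, where `m` is the degree of `f` and `θ_1, …, θ_m` is a given
enumeration, without repetition, of all the complex roots of `f`. -/
noncomputable def polyVandermonde (f : Polynomial ℤ) (θ : Fin f.natDegree ≃ f.rootSet ℂ) :
    Matrix (Fin f.natDegree) (Fin f.natDegree) ℂ :=
  Matrix.vandermonde fun i => (θ i : ℂ)

open scoped Matrix.Norms.Frobenius in
/-- The condition number `‖A‖ ‖A⁻¹‖` of a square complex matrix in the Frobenius norm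
(meaningful when `A` is invertible). -/
noncomputable def condNumber {m : ℕ} (A : Matrix (Fin m) (Fin m) ℂ) : ℝ :=
  ‖A‖ * ‖A⁻¹‖

/-- The norm used in `condNumber` is `√(∑ |a_ij|²)`. -/
theorem condNumber_eq {m : ℕ} (A : Matrix (Fin m) (Fin m) ℂ) :
    condNumber A =
      √(∑ i, ∑ j, ‖A i j‖ ^ 2) * √(∑ i, ∑ j, ‖A⁻¹ i j‖ ^ 2) := by
  simp [condNumber, Matrix.frobenius_norm_def, Real.sqrt_eq_rpow]

/-- The complex roots of a cyclotomic polynomial can be enumerated by its degree. -/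
theorem nonempty_cyclotomic_enumeration (n : ℕ) (hn : n ≠ 0) :
    Nonempty (Fin (Polynomial.cyclotomic n ℤ).natDegree ≃
      (Polynomial.cyclotomic n ℤ).rootSet ℂ) := by
  have : NeZero (n : ℂ) := ⟨by exact_mod_cast hn⟩
  have h : (Polynomial.cyclotomic n ℤ).rootSet ℂ = (primitiveRoots n ℂ : Set ℂ) := by
    rw [Polynomial.rootSet, Polynomial.aroots_def, algebraMap_int_eq,
      Polynomial.map_cyclotomic_int, Polynomial.cyclotomic.roots_eq_primitiveRoots_val]
    simp
  rw [h, Polynomial.natDegree_cyclotomic]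
  refine ⟨(Fintype.equivFinOfCardEq ?_).symm⟩
  simpa using (Complex.isPrimitiveRoot_exp n hn).card_primitiveRoots

/-- The function `n^(n^(1 / log log n) + log n / log log n + 3) · e^(n^(1 / log log n))`. -/
noncomputable def condBound (n : ℕ) : ℝ :=
  (n : ℝ) ^ ((n : ℝ) ^ (1 / Real.log (Real.log n)) +
      Real.log n / Real.log (Real.log n) + 3) *
    Real.exp ((n : ℝ) ^ (1 / Real.log (Real.log n)))

/-!
Write `ω(n)` for the number of prime divisors of `n`. The condition number is bounded explicitly,
`Cond(V) ≤ n ^ (3 + 2 * 2 ^ ω(n))` (`condNumber_polyVandermonde_cyclotomic_le`), and the exponent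
is then compared with that of `condBound`.

The entries of `V` have modulus one, and the columns of `V⁻¹` consist of the coefficients of the
Lagrange basis polynomials `Φ_n / ((X - ζ) Φ_n'(ζ))` (`polyVandermonde_inv_apply`). Both the
numerator and the denominator are controlled by `Φ_n = ∏_{e ∣ n} (X ^ e - 1) ^ μ(n / e)`, in which
only `2 ^ ω(n)` exponents are nonzero.

* Multiplying by `X ^ e - b` with `‖b‖ = 1` at most doubles the sum of the absolute values of the
  coefficients in degrees below `n`, and dividing by it multiplies this sum by at most `n`; hence
  the coefficients of `Φ_n / (X - ζ)` are at most `n ^ (2 ^ ω(n) + 1)`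
  (`coeffSum_cyclotomic_divByMonic_le`).
* Differentiating the product formula at `ζ` writes `Φ_n'(ζ)` as `n ζ ^ (n - 1)` times a product
  of powers `(ζ ^ e - 1) ^ μ(n / e)`, and `1 / n ≤ ‖ζ ^ e - 1‖ ≤ 2`; hence
  `1 / ‖Φ_n'(ζ)‖ ≤ n ^ 2 ^ ω(n)` (`one_le_mul_norm_eval_derivative_cyclotomic`).

Splitting the prime divisors of `n` at `(log n) ^ (9 / 10)` gives
`ω(n) ≤ (10 / 9 + o(1)) log n / log log n`. As `(10 / 9) log 2 < 1`, eventually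
`2 * 2 ^ ω(n) ≤ exp (log n / log log n) = n ^ (1 / log log n)`
(`eventually_two_mul_two_pow_card_primeFactors_le`), so the bound is `O(condBound n)`. The constant
for all `n ≥ 2` exists because `condBound` is positive.
-/

/-! ### Coefficients of products and quotients by binomials -/

open Polynomial in
/-- The sum of the absolute values of the coefficients of `P` in degrees below `N`. -/
noncomputable def coeffSum (N : ℕ) (P : ℂ[X]) : ℝ :=
  ∑ j ∈ Finset.range N, ‖P.coeff j‖

section CoeffSum

open Polynomial

theorem coeffSum_nonneg (N : ℕ) (P : ℂ[X]) : 0 ≤ coeffSum N P :=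
  Finset.sum_nonneg fun _ _ => norm_nonneg _

theorem coeffSum_mono {M N : ℕ} (h : M ≤ N) (P : ℂ[X]) : coeffSum M P ≤ coeffSum N P :=
  Finset.sum_le_sum_of_subset_of_nonneg (Finset.range_mono h) fun _ _ _ => norm_nonneg _

theorem norm_coeff_le_coeffSum {N j : ℕ} (h : j < N) (P : ℂ[X]) :
    ‖P.coeff j‖ ≤ coeffSum N P :=
  Finset.single_le_sum (f := fun j => ‖P.coeff j‖) (fun _ _ => norm_nonneg _)
    (Finset.mem_range.2 h)

theorem coeffSum_one_le (N : ℕ) : coeffSum N 1 ≤ 1 := by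
  unfold coeffSum
  calc ∑ j ∈ Finset.range N, ‖(1 : ℂ[X]).coeff j‖
      = ∑ j ∈ Finset.range N, if j = 0 then (1 : ℝ) else 0 := by
        refine Finset.sum_congr rfl fun j _ => ?_
        rw [coeff_one]; split_ifs <;> simp
    _ ≤ 1 := by rw [Finset.sum_ite_eq']; split_ifs <;> norm_num

theorem coeffSum_mul_X_pow_le (N : ℕ) (P : ℂ[X]) (e : ℕ) :
    coeffSum N (P * X ^ e) ≤ coeffSum N P := by
  unfold coeffSum
  rcases le_total e N with h | h
  · obtain ⟨k, rfl⟩ := Nat.exists_eq_add_of_le h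
    rw [Finset.sum_range_add]
    have h0 : ∑ j ∈ Finset.range e, ‖(P * X ^ e).coeff j‖ = 0 :=
      Finset.sum_eq_zero fun j hj => by
        rw [coeff_mul_X_pow', if_neg (by simpa using hj), norm_zero]
    rw [h0, zero_add]
    simp_rw [add_comm e, coeff_mul_X_pow]
    exact coeffSum_mono (Nat.le_add_right k e) P
  · rw [Finset.sum_eq_zero fun j hj => ?_]
    · exact coeffSum_nonneg N P
    · rw [coeff_mul_X_pow', if_neg (by have := Finset.mem_range.1 hj; omega), norm_zero]

theorem coeffSum_mul_X_pow_sub_C_le (N : ℕ) (P : ℂ[X]) (e : ℕ) {b : ℂ} (hb : ‖b‖ = 1) :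
    coeffSum N (P * (X ^ e - C b)) ≤ 2 * coeffSum N P := by
  calc coeffSum N (P * (X ^ e - C b)) ≤ coeffSum N (P * X ^ e) + coeffSum N P := by
        unfold coeffSum
        rw [← Finset.sum_add_distrib]
        refine Finset.sum_le_sum fun j _ => ?_
        rw [mul_sub, coeff_sub, coeff_mul_C]
        refine (norm_sub_le _ _).trans_eq ?_
        rw [norm_mul, hb, mul_one]
    _ ≤ 2 * coeffSum N P := by linarith [coeffSum_mul_X_pow_le N P e]

/-- The coefficient of `X ^ j` in a quotient by `X ^ e - b` is, up to factors of modulus one, the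
sum of the coefficients of the dividend in the degrees `j`, `j - e`, `j - 2 * e`, … -/
theorem norm_coeff_le_coeffSum_mul_X_pow_sub_C (P : ℂ[X]) {e : ℕ} (he : 0 < e) {b : ℂ}
    (hb : ‖b‖ = 1) (j : ℕ) :
    ‖P.coeff j‖ ≤ coeffSum (j + 1) (P * (X ^ e - C b)) := by
  induction j using Nat.strong_induction_on with
  | _ j ih =>
    have h1 : (P * (X ^ e - C b)).coeff j = (P * X ^ e).coeff j - P.coeff j * b := by
      rw [mul_sub, coeff_sub, coeff_mul_C]
    have h2 : ‖P.coeff j‖ ≤ ‖(P * X ^ e).coeff j‖ + ‖(P * (X ^ e - C b)).coeff j‖ := by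
      have h : P.coeff j * b = (P * X ^ e).coeff j - (P * (X ^ e - C b)).coeff j := by
        rw [h1, sub_sub_cancel]
      rw [← mul_one ‖P.coeff j‖, ← hb, ← norm_mul, h]
      exact norm_sub_le _ _
    have h3 : ‖(P * X ^ e).coeff j‖ ≤ coeffSum j (P * (X ^ e - C b)) := by
      rw [coeff_mul_X_pow']
      split_ifs with h
      · exact (ih (j - e) (by omega)).trans (coeffSum_mono (by omega) _)
      · rw [norm_zero]; exact coeffSum_nonneg _ _
    have h4 : coeffSum (j + 1) (P * (X ^ e - C b)) =
        coeffSum j (P * (X ^ e - C b)) + ‖(P * (X ^ e - C b)).coeff j‖ :=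
      Finset.sum_range_succ _ _
    linarith

theorem coeffSum_le_mul_coeffSum_mul_X_pow_sub_C (N : ℕ) (P : ℂ[X]) {e : ℕ} (he : 0 < e) {b : ℂ}
    (hb : ‖b‖ = 1) :
    coeffSum N P ≤ N * coeffSum N (P * (X ^ e - C b)) := by
  have := Finset.sum_le_card_nsmul (Finset.range N) (fun j => ‖P.coeff j‖)
    (coeffSum N (P * (X ^ e - C b))) fun j hj =>
      (norm_coeff_le_coeffSum_mul_X_pow_sub_C P he hb j).trans
        (coeffSum_mono (Finset.mem_range.1 hj) _)
  simpa [coeffSum] using this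

theorem coeffSum_prod_X_pow_sub_one_le (N : ℕ) (s : Finset ℕ) :
    coeffSum N (∏ e ∈ s, (X ^ e - 1 : ℂ[X])) ≤ 2 ^ s.card := by
  induction s using Finset.induction_on with
  | empty => simpa using coeffSum_one_le N
  | insert a s ha ih =>
    rw [Finset.prod_insert ha, mul_comm, Finset.card_insert_of_notMem ha, pow_succ, ← C_1]
    rw [← C_1] at ih
    linarith [coeffSum_mul_X_pow_sub_C_le N (∏ e ∈ s, (X ^ e - C 1 : ℂ[X])) a (b := 1) (by simp)]

theorem coeffSum_le_pow_mul_coeffSum_mul_prod (N : ℕ) (P : ℂ[X]) (s : Finset ℕ)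
    (hs : ∀ e ∈ s, 0 < e) :
    coeffSum N P ≤ N ^ s.card * coeffSum N (P * ∏ e ∈ s, (X ^ e - 1 : ℂ[X])) := by
  induction s using Finset.induction_on with
  | empty => simp
  | insert a s ha ih =>
    have h1 := ih fun e he => hs e (Finset.mem_insert_of_mem he)
    have h2 := coeffSum_le_mul_coeffSum_mul_X_pow_sub_C N
      (P * ∏ e ∈ s, (X ^ e - 1 : ℂ[X])) (hs a (Finset.mem_insert_self a s)) (b := 1) (by simp)
    rw [C_1] at h2
    rw [Finset.prod_insert ha, mul_comm (X ^ a - 1 : ℂ[X]), ← mul_assoc P,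
      Finset.card_insert_of_notMem ha, pow_succ, mul_assoc]
    exact h1.trans (mul_le_mul_of_nonneg_left h2 (by positivity))

end CoeffSum

/-! ### The product formula for cyclotomic polynomials and their derivative at a root -/

/-- The divisors `e` of `n` for which the Möbius function takes the value `s` at `n / e`. For
`s = 1` and `s = -1` these are the exponents in the numerator and the denominator of
`Φ_n = ∏ (X ^ e - 1) ^ μ (n / e)`. -/
def moebiusDivisors (n : ℕ) (s : ℤ) : Finset ℕ :=
  n.divisors.filter fun e => ArithmeticFunction.moebius (n / e) = s

section Moebius

open Polynomial

theorem pos_of_mem_moebiusDivisors {n e : ℕ} {s : ℤ} (h : e ∈ moebiusDivisors n s) : 0 < e :=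
  Nat.pos_of_mem_divisors (Finset.mem_filter.1 h).1

theorem self_mem_moebiusDivisors {n : ℕ} (hn : n ≠ 0) : n ∈ moebiusDivisors n 1 := by
  simp [moebiusDivisors, hn, Nat.div_self (Nat.pos_of_ne_zero hn)]

theorem card_moebiusDivisors_add_le {n : ℕ} (hn : n ≠ 0) :
    (moebiusDivisors n 1).card + (moebiusDivisors n (-1)).card ≤ 2 ^ n.primeFactors.card := by
  have hd : Disjoint (moebiusDivisors n 1) (moebiusDivisors n (-1)) := by
    refine Finset.disjoint_left.2 fun e h1 h2 => ?_
    have := (Finset.mem_filter.1 h1).2.symm.trans (Finset.mem_filter.1 h2).2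
    norm_num at this
  have hsq : (n.divisors.filter Squarefree).card = 2 ^ n.primeFactors.card := by
    rw [Finset.card_eq_sum_ones, Nat.sum_divisors_filter_squarefree hn]
    simp only [Finset.sum_const, Finset.card_powerset, smul_eq_mul, mul_one, Nat.factors_eq]
    rfl
  rw [← Finset.card_union_of_disjoint hd, ← hsq]
  refine Finset.card_le_card_of_injOn (fun e => n / e) (fun e he => ?_) fun a ha b hb hab => ?_
  · rw [Finset.mem_coe, Finset.mem_union] at he
    rw [Finset.mem_coe, Finset.mem_filter, ← ArithmeticFunction.moebius_ne_zero_iff_squarefree,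
      ArithmeticFunction.moebius_ne_zero_iff_eq_or]
    have hdvd : e ∣ n := by
      rcases he with he | he <;> exact Nat.dvd_of_mem_divisors (Finset.mem_filter.1 he).1
    refine ⟨Nat.mem_divisors.2 ⟨Nat.div_dvd_of_dvd hdvd, hn⟩, ?_⟩
    rcases he with he | he
    · exact .inl (Finset.mem_filter.1 he).2
    · exact .inr (Finset.mem_filter.1 he).2
  · have key : ∀ e ∈ (↑(moebiusDivisors n 1 ∪ moebiusDivisors n (-1)) : Set ℕ),
        n / (n / e) = e := fun e he => by
      rw [Finset.mem_coe, Finset.mem_union] at he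
      refine Nat.div_div_self ?_ hn
      rcases he with he | he <;> exact Nat.dvd_of_mem_divisors (Finset.mem_filter.1 he).1
    rw [← key a ha, ← key b hb]
    exact congrArg (n / ·) hab

theorem cyclotomic_mul_prod_moebiusDivisors (n : ℕ) :
    cyclotomic n ℂ * ∏ e ∈ moebiusDivisors n (-1), (X ^ e - 1 : ℂ[X]) =
      ∏ e ∈ moebiusDivisors n 1, (X ^ e - 1 : ℂ[X]) := by
  apply RatFunc.algebraMap_injective ℂ
  rw [map_mul, cyclotomic_eq_prod_X_pow_sub_one_pow_moebius,
    Nat.prod_divisorsAntidiagonal' (fun a b => algebraMap ℂ[X] (RatFunc ℂ) (X ^ b - 1) ^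
      ArithmeticFunction.moebius a), map_prod, map_prod]
  simp only [moebiusDivisors, Finset.prod_filter]
  rw [← Finset.prod_mul_distrib]
  refine Finset.prod_congr rfl fun e he => ?_
  have hne : algebraMap ℂ[X] (RatFunc ℂ) (X ^ e - 1) ≠ 0 := by
    rw [Ne, map_eq_zero_iff _ (RatFunc.algebraMap_injective ℂ), ← C_1]
    exact X_pow_sub_C_ne_zero (Nat.pos_of_mem_divisors he) 1
  rcases ArithmeticFunction.moebius_eq_or (n / e) with h | h | h <;>
    simp [h, -map_sub, hne]

/-- A root of unity of order dividing `n` is either `1` or at distance at least `1 / n` from `1`: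
the sum of its first `n` powers vanishes, so that `n` is the sum of the `1 - z ^ k`,
each of absolute value at most `n * ‖z - 1‖`. -/
theorem one_le_mul_norm_sub_one {n : ℕ} {z : ℂ} (hz : z ^ n = 1) (hz1 : z ≠ 1) (hn : 0 < n) :
    1 ≤ n * ‖z - 1‖ := by
  have hnorm : ‖z‖ = 1 := Complex.norm_eq_one_of_pow_eq_one hz hn.ne'
  have hpow : ∀ k : ℕ, ‖1 - z ^ k‖ ≤ k * ‖z - 1‖ := by
    intro k
    rw [norm_sub_rev, ← geom_sum_mul, norm_mul]
    gcongr
    refine (norm_sum_le _ _).trans ?_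
    simp [hnorm]
  have hsum : ∑ k ∈ Finset.range n, (1 - z ^ k) = n := by
    have : ∑ k ∈ Finset.range n, z ^ k = 0 := by
      have := geom_sum_mul z n
      rw [hz, sub_self] at this
      exact (mul_eq_zero.1 this).resolve_right (sub_ne_zero.2 hz1)
    rw [Finset.sum_sub_distrib, this]; simp
  have h : (n : ℝ) ≤ n * (n * ‖z - 1‖) := by
    calc (n : ℝ) = ‖∑ k ∈ Finset.range n, (1 - z ^ k)‖ := by rw [hsum]; simp
      _ ≤ ∑ k ∈ Finset.range n, ‖1 - z ^ k‖ := norm_sum_le _ _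
      _ ≤ ∑ k ∈ Finset.range n, n * ‖z - 1‖ := by
        refine Finset.sum_le_sum fun k hk => (hpow k).trans ?_
        gcongr
        exact (Finset.mem_range.1 hk).le
      _ = n * (n * ‖z - 1‖) := by simp
  have hn' : (0 : ℝ) < n := by exact_mod_cast hn
  exact le_of_mul_le_mul_left (by linarith) hn'

/-- The derivative of `Φ_n` at a primitive root `ζ`, obtained by differentiating the product
formula for `Φ_n`: all terms but the derivative of the factor `X ^ n - 1` vanish at `ζ`. -/
theorem eval_derivative_cyclotomic_mul_prod {n : ℕ} (hn : n ≠ 0) {ζ : ℂ}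
    (hζ : IsPrimitiveRoot ζ n) :
    (derivative (cyclotomic n ℂ)).eval ζ * ∏ e ∈ moebiusDivisors n (-1), (ζ ^ e - 1) =
      n * ζ ^ (n - 1) * ∏ e ∈ (moebiusDivisors n 1).erase n, (ζ ^ e - 1) := by
  have h0 : (cyclotomic n ℂ).eval ζ = 0 := hζ.isRoot_cyclotomic (Nat.pos_of_ne_zero hn)
  have h := congrArg (fun p => (derivative p).eval ζ) (cyclotomic_mul_prod_moebiusDivisors n)
  rw [← Finset.mul_prod_erase _ _ (self_mem_moebiusDivisors hn)] at h
  simpa [h0, hζ.pow_eq_one, eval_prod, derivative_X_pow] using h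

theorem one_le_mul_norm_eval_derivative_cyclotomic {n : ℕ} (hn : 2 ≤ n) {ζ : ℂ}
    (hζ : IsPrimitiveRoot ζ n) :
    1 ≤ (n : ℝ) ^ 2 ^ n.primeFactors.card * ‖(derivative (cyclotomic n ℂ)).eval ζ‖ := by
  have hn0 : n ≠ 0 := by omega
  have hn2 : (2 : ℝ) ≤ n := by exact_mod_cast hn
  have hnorm : ‖ζ‖ = 1 := hζ.norm'_eq_one hn0
  set A := moebiusDivisors n 1
  set B := moebiusDivisors n (-1)
  have h1 : ‖∏ e ∈ B, (ζ ^ e - 1)‖ ≤ (n : ℝ) ^ B.card := by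
    rw [norm_prod, ← Finset.prod_const]
    refine Finset.prod_le_prod (fun _ _ => norm_nonneg _) fun e _ => (norm_sub_le _ _).trans ?_
    rw [norm_pow, hnorm]; norm_num; linarith
  have h2 : 1 ≤ (n : ℝ) ^ (A.erase n).card * ‖∏ e ∈ A.erase n, (ζ ^ e - 1)‖ := by
    rw [norm_prod, ← Finset.prod_const, ← Finset.prod_mul_distrib]
    refine Finset.one_le_prod fun e he => ?_
    obtain ⟨hne, he⟩ := Finset.mem_erase.1 he
    refine one_le_mul_norm_sub_one ?_ (fun h => hne ?_) (Nat.pos_of_ne_zero hn0)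
    · rw [← pow_mul, mul_comm, pow_mul, hζ.pow_eq_one, one_pow]
    · exact Nat.dvd_antisymm (Nat.dvd_of_mem_divisors (Finset.mem_filter.1 he).1)
        (hζ.dvd_of_pow_eq_one e h)
  have h3 := congrArg norm (eval_derivative_cyclotomic_mul_prod hn0 hζ)
  rw [norm_mul, norm_mul, norm_mul, norm_pow, hnorm, one_pow, mul_one,
    Complex.norm_natCast] at h3
  have hcard : A.card + B.card ≤ 2 ^ n.primeFactors.card := card_moebiusDivisors_add_le hn0
  have hA : (A.erase n).card + 1 = A.card :=
    Finset.card_erase_add_one (self_mem_moebiusDivisors hn0)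
  set D := ‖(derivative (cyclotomic n ℂ)).eval ζ‖
  calc (1 : ℝ) ≤ (n : ℝ) ^ (A.erase n).card * ‖∏ e ∈ A.erase n, (ζ ^ e - 1)‖ := h2
    _ ≤ (n : ℝ) ^ (A.erase n).card * (n * ‖∏ e ∈ A.erase n, (ζ ^ e - 1)‖) := by
      gcongr
      exact le_mul_of_one_le_left (norm_nonneg _) (by linarith)
    _ = (n : ℝ) ^ (A.erase n).card * (D * ‖∏ e ∈ B, (ζ ^ e - 1)‖) := by rw [h3]
    _ ≤ (n : ℝ) ^ (A.erase n).card * (D * (n : ℝ) ^ B.card) := by gcongr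
    _ = (n : ℝ) ^ ((A.erase n).card + B.card) * D := by rw [pow_add]; ring
    _ ≤ (n : ℝ) ^ 2 ^ n.primeFactors.card * D := by
      gcongr
      · linarith
      · omega

end Moebius

/-! ### The inverse of the Vandermonde matrix -/

section Vandermonde

open Polynomial

theorem isUnit_polyVandermonde (f : ℤ[X]) (θ : Fin f.natDegree ≃ f.rootSet ℂ) :
    IsUnit (polyVandermonde f θ) := by
  rw [Matrix.isUnit_iff_isUnit_det, isUnit_iff_ne_zero]
  exact Matrix.det_vandermonde_ne_zero_iff.2 (Subtype.val_injective.comp θ.injective)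

/-- The columns of the inverse of a Vandermonde matrix consist of the coefficients of the
Lagrange basis polynomials `f / ((X - θ_i) f'(θ_i))`. -/
theorem polyVandermonde_inv_apply (f : ℤ[X]) (θ : Fin f.natDegree ≃ f.rootSet ℂ)
    (hf : f.Monic) (hsep : ∀ i, (derivative (f.map (Int.castRingHom ℂ))).eval (θ i : ℂ) ≠ 0)
    (j i : Fin f.natDegree) :
    (polyVandermonde f θ)⁻¹ j i =
      (f.map (Int.castRingHom ℂ) /ₘ (X - C (θ i : ℂ))).coeff j /
        (derivative (f.map (Int.castRingHom ℂ))).eval (θ i : ℂ) := by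
  set F := f.map (Int.castRingHom ℂ) with hF
  have hFm : F.Monic := hf.map _
  have hdeg : F.natDegree = f.natDegree := hf.natDegree_map _
  have hroot : ∀ i, F.eval (θ i : ℂ) = 0 := fun i => by
    have := (mem_rootSet.1 (θ i).2).2
    rwa [aeval_def, ← eval_map] at this
  have hmul : ∀ i, (X - C (θ i : ℂ)) * (F /ₘ (X - C (θ i : ℂ))) = F := fun i =>
    mul_divByMonic_eq_iff_isRoot.2 (hroot i)
  set W : Matrix (Fin f.natDegree) (Fin f.natDegree) ℂ := Matrix.of fun j i =>
    (F /ₘ (X - C (θ i : ℂ))).coeff j / (derivative F).eval (θ i : ℂ) with hW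
  suffices h : polyVandermonde f θ * W = 1 by
    rw [Matrix.inv_eq_right_inv h]; rfl
  ext k i
  have hlt : (F /ₘ (X - C (θ i : ℂ))).natDegree < f.natDegree := by
    rw [natDegree_divByMonic _ (monic_X_sub_C _), natDegree_X_sub_C, hdeg]
    have := k.pos
    omega
  have heval : (polyVandermonde f θ * W) k i =
      (F /ₘ (X - C (θ i : ℂ))).eval (θ k : ℂ) / (derivative F).eval (θ i : ℂ) := by
    rw [Matrix.mul_apply, eval_eq_sum_range' hlt, ← Fin.sum_univ_eq_sum_range
      (fun j => (F /ₘ (X - C (θ i : ℂ))).coeff j * (θ k : ℂ) ^ j), Finset.sum_div]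
    refine Finset.sum_congr rfl fun j _ => ?_
    simp only [polyVandermonde, Matrix.vandermonde_apply, hW, Matrix.of_apply]
    ring
  rw [heval, Matrix.one_apply]
  split_ifs with hki
  · subst hki
    have := congrArg (eval (θ k : ℂ))
      (divByMonic_add_X_sub_C_mul_derivative_divByMonic_eq_derivative F (θ k : ℂ))
    rw [eval_add, eval_mul, eval_sub, eval_X, eval_C, sub_self, zero_mul, add_zero] at this
    rw [this, div_self (hsep k)]
  · have := congrArg (eval (θ k : ℂ)) (hmul i)
    rw [hroot k, eval_mul, eval_sub, eval_X, eval_C] at this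
    have hne : (θ k : ℂ) - θ i ≠ 0 :=
      sub_ne_zero.2 fun h => hki (θ.injective (Subtype.ext h))
    rw [(mul_eq_zero.1 this).resolve_left hne, zero_div]

theorem sqrt_sum_sq_norm_le {m : ℕ} (A : Matrix (Fin m) (Fin m) ℂ) {M : ℝ} (hM : 0 ≤ M)
    (h : ∀ i j, ‖A i j‖ ≤ M) : √(∑ i, ∑ j, ‖A i j‖ ^ 2) ≤ m * M := by
  refine Real.sqrt_le_iff.2 ⟨by positivity, ?_⟩
  calc ∑ i, ∑ j, ‖A i j‖ ^ 2 ≤ ∑ _i : Fin m, ∑ _j : Fin m, M ^ 2 := by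
        gcongr with i _ j _
        exact h i j
    _ = (m * M) ^ 2 := by simp; ring

/-- The coefficients of `Φ_n / (X - ζ)` add up to at most `n ^ (2 ^ ω(n) + 1)` in absolute value:
this polynomial is a quotient of products of at most `2 ^ ω(n) + 1` binomials, and
multiplication or division by a binomial costs at most a factor `n` in degrees below `n`. -/
theorem coeffSum_cyclotomic_divByMonic_le {n : ℕ} (hn : 2 ≤ n) {ζ : ℂ}
    (hζ : IsPrimitiveRoot ζ n) :
    coeffSum n (cyclotomic n ℂ /ₘ (X - C ζ)) ≤ (n : ℝ) ^ (2 ^ n.primeFactors.card + 1) := by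
  have hn0 : n ≠ 0 := by omega
  have hn2 : (2 : ℝ) ≤ n := by exact_mod_cast hn
  set Q := cyclotomic n ℂ /ₘ (X - C ζ)
  have hQ : (X - C ζ) * Q = cyclotomic n ℂ :=
    mul_divByMonic_eq_iff_isRoot.2 (hζ.isRoot_cyclotomic (Nat.pos_of_ne_zero hn0))
  have h1 := coeffSum_le_mul_coeffSum_mul_X_pow_sub_C n Q one_pos (hζ.norm'_eq_one hn0)
  rw [pow_one, mul_comm Q, hQ] at h1
  have h2 := coeffSum_le_pow_mul_coeffSum_mul_prod n (cyclotomic n ℂ) (moebiusDivisors n (-1))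
    fun e he => pos_of_mem_moebiusDivisors he
  rw [cyclotomic_mul_prod_moebiusDivisors] at h2
  have h3 := coeffSum_prod_X_pow_sub_one_le n (moebiusDivisors n 1)
  calc coeffSum n Q ≤ n * coeffSum n (cyclotomic n ℂ) := h1
    _ ≤ n * (n ^ (moebiusDivisors n (-1)).card *
          coeffSum n (∏ e ∈ moebiusDivisors n 1, (X ^ e - 1 : ℂ[X]))) := by gcongr
    _ ≤ n * (n ^ (moebiusDivisors n (-1)).card * n ^ (moebiusDivisors n 1).card) := by
      gcongr
      exact h3.trans (by gcongr)
    _ = (n : ℝ) ^ ((moebiusDivisors n 1).card + (moebiusDivisors n (-1)).card + 1) := by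
      ring
    _ ≤ (n : ℝ) ^ (2 ^ n.primeFactors.card + 1) := by
      gcongr
      · linarith
      · exact card_moebiusDivisors_add_le hn0

theorem condNumber_polyVandermonde_cyclotomic_le {n : ℕ} (hn : 2 ≤ n)
    (θ : Fin (cyclotomic n ℤ).natDegree ≃ (cyclotomic n ℤ).rootSet ℂ) :
    condNumber (polyVandermonde (cyclotomic n ℤ) θ) ≤
      (n : ℝ) ^ (3 + 2 * 2 ^ n.primeFactors.card) := by
  have hn0 : n ≠ 0 := by omega
  have : NeZero (n : ℂ) := ⟨by exact_mod_cast hn0⟩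
  have hprim : ∀ i, IsPrimitiveRoot (θ i : ℂ) n := fun i => by
    have := (mem_rootSet.1 (θ i).2).2
    rw [aeval_def, ← eval_map, algebraMap_int_eq, map_cyclotomic_int] at this
    exact isRoot_cyclotomic_iff.1 this
  have hm : (cyclotomic n ℤ).natDegree ≤ n := by
    rw [natDegree_cyclotomic]; exact Nat.totient_le n
  have hder : ∀ i, 1 ≤ (n : ℝ) ^ 2 ^ n.primeFactors.card *
      ‖(derivative (cyclotomic n ℂ)).eval (θ i : ℂ)‖ := fun i =>
    one_le_mul_norm_eval_derivative_cyclotomic hn (hprim i)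
  have hder0 : ∀ i, 0 < ‖(derivative (cyclotomic n ℂ)).eval (θ i : ℂ)‖ := fun i =>
    pos_of_mul_pos_right (zero_lt_one.trans_le (hder i)) (by positivity)
  set ω := n.primeFactors.card
  have hV : ∀ i j, ‖polyVandermonde (cyclotomic n ℤ) θ i j‖ ≤ 1 := fun i j => by
    rw [polyVandermonde, Matrix.vandermonde_apply, norm_pow, (hprim i).norm'_eq_one hn0, one_pow]
  have hW : ∀ j i, ‖(polyVandermonde (cyclotomic n ℤ) θ)⁻¹ j i‖ ≤
      (n : ℝ) ^ (2 ^ ω + 1) * (n : ℝ) ^ 2 ^ ω := fun j i => by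
    rw [polyVandermonde_inv_apply _ θ (cyclotomic.monic n ℤ)
      (fun i => by rw [map_cyclotomic_int]; exact norm_pos_iff.1 (hder0 i)),
      map_cyclotomic_int, norm_div, div_le_iff₀ (hder0 i), mul_assoc]
    refine (norm_coeff_le_coeffSum (j.2.trans_le hm) _).trans
      ((coeffSum_cyclotomic_divByMonic_le hn (hprim i)).trans ?_)
    exact le_mul_of_one_le_right (by positivity) (hder i)
  rw [condNumber_eq]
  calc _ ≤ ((cyclotomic n ℤ).natDegree * 1) * ((cyclotomic n ℤ).natDegree *
        ((n : ℝ) ^ (2 ^ ω + 1) * (n : ℝ) ^ 2 ^ ω)) :=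
        mul_le_mul (sqrt_sum_sq_norm_le _ zero_le_one hV)
          (sqrt_sum_sq_norm_le _ (by positivity) hW) (by positivity) (by positivity)
    _ ≤ (n * 1) * (n * ((n : ℝ) ^ (2 ^ ω + 1) * (n : ℝ) ^ 2 ^ ω)) := by gcongr
    _ = (n : ℝ) ^ (3 + 2 * 2 ^ ω) := by ring

end Vandermonde

/-! ### The number of prime divisors and the growth of the bound -/

section Growth

open Filter Real

/-- Split the prime divisors of `n` at `y`: there are at most `y` small ones, and the product of
the large ones divides `n`. -/
theorem card_primeFactors_le_add_log_div_log {n : ℕ} (hn : n ≠ 0) {y : ℝ} (hy : 1 < y) :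
    (n.primeFactors.card : ℝ) ≤ y + log n / log y := by
  have h1 : ((n.primeFactors.filter fun p : ℕ => (p : ℝ) ≤ y).card : ℝ) ≤ y := by
    have hsub : (n.primeFactors.filter fun p : ℕ => (p : ℝ) ≤ y) ⊆ Finset.Ioc 0 ⌊y⌋₊ := by
      intro p hp
      obtain ⟨hp, hpy⟩ := Finset.mem_filter.1 hp
      exact Finset.mem_Ioc.2 ⟨(Nat.prime_of_mem_primeFactors hp).pos, Nat.le_floor hpy⟩
    have := Finset.card_le_card hsub
    rw [Nat.card_Ioc, Nat.sub_zero] at this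
    exact (Nat.cast_le.2 this).trans (Nat.floor_le (by linarith))
  have h2 : ((n.primeFactors.filter fun p : ℕ => ¬ (p : ℝ) ≤ y).card : ℝ) ≤
      log n / log y := by
    rw [le_div_iff₀ (log_pos hy), ← log_pow]
    refine log_le_log (by positivity) ?_
    calc y ^ (n.primeFactors.filter fun p : ℕ => ¬ (p : ℝ) ≤ y).card
        ≤ ∏ p ∈ n.primeFactors.filter fun p : ℕ => ¬ (p : ℝ) ≤ y, (p : ℝ) := by
          rw [← Finset.prod_const]
          refine Finset.prod_le_prod (fun _ _ => by linarith) fun p hp => ?_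
          exact (not_le.1 (Finset.mem_filter.1 hp).2).le
      _ ≤ n := by
          rw [← Nat.cast_prod]
          exact_mod_cast Nat.le_of_dvd (Nat.pos_of_ne_zero hn)
            ((Finset.prod_dvd_prod_of_subset _ _ _ (Finset.filter_subset _ _)).trans
              (Nat.prod_primeFactors_dvd n))
  rw [← Finset.card_filter_add_card_filter_not (fun p : ℕ => (p : ℝ) ≤ y)]
  push_cast
  linarith

theorem tendsto_log_natCast_atTop : Tendsto (fun n : ℕ => log n) atTop atTop :=
  tendsto_log_atTop.comp tendsto_natCast_atTop_atTop

/-- Since `log 2 < 1`, twice the number `2 ^ ω(n)` of squarefree divisors is eventually less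
than `n ^ (1 / log log n)`. -/
theorem eventually_two_mul_two_pow_card_primeFactors_le :
    ∀ᶠ n : ℕ in atTop,
      2 * (2 : ℝ) ^ n.primeFactors.card ≤ (n : ℝ) ^ (1 / log (log n)) := by
  have hlog : ∀ᶠ x : ℝ in atTop, log x ≤ 1 / 10 * x ^ (1 / 10 : ℝ) := by
    filter_upwards [(isLittleO_log_rpow_atTop (r := 1 / 10) (by norm_num)).bound
      (c := 1 / 10) (by norm_num), eventually_ge_atTop 0] with x hx hx0
    rw [norm_eq_abs, norm_eq_abs, abs_of_nonneg (rpow_nonneg hx0 _)] at hx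
    exact (le_abs_self _).trans hx
  filter_upwards [tendsto_log_natCast_atTop.eventually hlog,
    tendsto_log_natCast_atTop.eventually_gt_atTop 1, eventually_gt_atTop 0] with n h1 hL hn
  set L := log (n : ℝ)
  have hlogL : 0 < log L := log_pos hL
  have hn' : (0 : ℝ) < n := by exact_mod_cast hn
  have hy : 1 < L ^ (9 / 10 : ℝ) := one_lt_rpow hL (by norm_num)
  have hω := card_primeFactors_le_add_log_div_log hn.ne' hy
  rw [log_rpow (by linarith)] at hω
  have hprod : L ^ (9 / 10 : ℝ) * L ^ (1 / 10 : ℝ) = L := by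
    rw [← rpow_add (by linarith)]; norm_num
  have hmain : log 2 * ((n.primeFactors.card : ℝ) + 1) ≤ L / log L := by
    -- The small primes contribute `O(L ^ (9/10)) = o(L / log L)`, the large ones at most
    -- `(10/9) * L / log L`, which is good enough because `log 2 < 7/10 < 9/10`.
    have hsmall : 1 + L ^ (9 / 10 : ℝ) ≤ (1 / 5) * (L / log L) := by
      rw [← mul_div_assoc, le_div_iff₀ hlogL]
      calc (1 + L ^ (9 / 10 : ℝ)) * log L
          ≤ (2 * L ^ (9 / 10 : ℝ)) * (1 / 10 * L ^ (1 / 10 : ℝ)) := by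
            gcongr
            linarith
        _ = 1 / 5 * L := by linear_combination (1 / 5) * hprod
    have hlarge : L / (9 / 10 * log L) = 10 / 9 * (L / log L) := by field_simp
    have hpos : 0 < L / log L := by positivity
    have hcard : (n.primeFactors.card : ℝ) + 1 ≤ (1 / 5 + 10 / 9) * (L / log L) := by
      rw [hlarge] at hω; linarith
    calc log 2 * ((n.primeFactors.card : ℝ) + 1)
        ≤ (7 / 10) * ((1 / 5 + 10 / 9) * (L / log L)) := by
          gcongr
          linarith [log_two_lt_d9]
      _ ≤ L / log L := by linarith
  calc 2 * (2 : ℝ) ^ n.primeFactors.card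
      = exp (log 2 * ((n.primeFactors.card : ℝ) + 1)) := by
        rw [← rpow_def_of_pos two_pos, rpow_add_one two_ne_zero, rpow_natCast, mul_comm]
    _ ≤ exp (L / log L) := exp_le_exp.2 hmain
    _ = (n : ℝ) ^ (1 / log L) := by rw [rpow_def_of_pos hn', mul_one_div]

theorem condBound_pos {n : ℕ} (hn : 0 < n) : 0 < condBound n := by
  have : (0 : ℝ) < n := by exact_mod_cast hn
  unfold condBound
  positivity

theorem pow_isBigO_condBound :
    (fun n : ℕ => (n : ℝ) ^ (3 + 2 * 2 ^ n.primeFactors.card)) =O[atTop] condBound := by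
  refine Asymptotics.IsBigO.of_bound 1 ?_
  filter_upwards [eventually_two_mul_two_pow_card_primeFactors_le,
    tendsto_log_natCast_atTop.eventually_gt_atTop 1, eventually_gt_atTop 0] with n h hL hn
  have hn' : (1 : ℝ) ≤ n := by exact_mod_cast hn
  rw [one_mul, norm_eq_abs, norm_eq_abs, abs_of_pos (condBound_pos hn),
    abs_of_nonneg (by positivity), ← rpow_natCast]
  have hdiv : 0 ≤ log n / log (log n) := div_nonneg (by linarith) (log_pos hL).le
  refine le_trans (rpow_le_rpow_of_exponent_le hn' ?_)
    (le_mul_of_one_le_right (by positivity) (one_le_exp (by positivity)))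
  push_cast
  linarith

theorem condBound_isBigO_exp_rpow {ε : ℝ} (hε : 0 < ε) :
    condBound =O[atTop] fun n : ℕ => exp ((n : ℝ) ^ ε) := by
  refine Asymptotics.IsBigO.of_bound 1 ?_
  have hlin : ∀ᶠ x : ℝ in atTop, 6 * x ≤ exp (ε / 2 * x) := by
    filter_upwards [(isLittleO_pow_exp_pos_mul_atTop 1 (half_pos hε)).bound
      (c := 1 / 6) (by norm_num), eventually_ge_atTop 0] with x hx hx0
    rw [pow_one, norm_eq_abs, norm_eq_abs, abs_of_nonneg hx0, abs_of_pos (exp_pos _)] at hx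
    linarith
  filter_upwards [tendsto_log_natCast_atTop.eventually hlin,
    tendsto_log_natCast_atTop.eventually_gt_atTop 1,
    (tendsto_log_atTop.comp tendsto_log_natCast_atTop).eventually_ge_atTop (max 1 (2 / ε)),
    eventually_gt_atTop 0] with n h6 hL hlogL hn
  have hn' : (0 : ℝ) < n := by exact_mod_cast hn
  rw [one_mul, norm_eq_abs, norm_eq_abs, abs_of_pos (condBound_pos hn), abs_of_pos (exp_pos _),
    condBound]
  simp only [rpow_def_of_pos hn', ← exp_add]
  rw [exp_le_exp, mul_one_div]
  simp only [Function.comp_apply] at hlogL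
  set L := log (n : ℝ)
  obtain ⟨hl1, hl2⟩ := max_le_iff.1 hlogL
  have hu0 : 0 ≤ L / log L := by positivity
  have hu1 : L / log L ≤ ε / 2 * L := by
    rw [div_le_iff₀ (by linarith)]
    have : 1 ≤ ε / 2 * log L := by
      rw [div_le_iff₀ hε] at hl2; linarith
    nlinarith
  have hexp := add_one_le_exp (L / log L)
  set N := exp (L / log L)
  calc L * (N + L / log L + 3) + N ≤ 6 * L * N := by nlinarith
    _ ≤ exp (ε / 2 * L) * exp (ε / 2 * L) := by
      gcongr
      exact exp_le_exp.2 hu1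
    _ = exp (L * ε) := by rw [← exp_add]; ring_nf

end Growth

theorem theorem5p4 :
    (∃ C : ℝ, 0 < C ∧ ∀ n : ℕ, 2 ≤ n →
      ∀ θ : Fin (Polynomial.cyclotomic n ℤ).natDegree ≃ (Polynomial.cyclotomic n ℤ).rootSet ℂ,
        IsUnit (polyVandermonde (Polynomial.cyclotomic n ℤ) θ) ∧
        condNumber (polyVandermonde (Polynomial.cyclotomic n ℤ) θ) ≤ C * condBound n) ∧
    (∀ ε : ℝ, 0 < ε →
      condBound =O[Filter.atTop] fun n : ℕ => Real.exp ((n : ℝ) ^ ε)) := by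
  refine ⟨?_, fun ε hε => condBound_isBigO_exp_rpow hε⟩
  obtain ⟨C, hC, h⟩ := Asymptotics.bound_of_isBigO_nat_atTop pow_isBigO_condBound
  refine ⟨C, hC, fun n hn θ => ⟨isUnit_polyVandermonde _ θ, ?_⟩⟩
  have hpos : 0 < condBound n := condBound_pos (by omega)
  have hb := h hpos.ne'
  rw [Real.norm_eq_abs, Real.norm_eq_abs, abs_of_pos hpos, abs_of_nonneg (by positivity)] at hb
  exact (condNumber_polyVandermonde_cyclotomic_le hn θ).trans hb
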